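/- Let $q$ be a prime power not divisible by $3$, and let $\epsilon=\left(\frac{q}{3}\right)$ be the Legendre symbol, so that $\epsilon=1$ if $q\equiv 1\pmod 3$ and $\epsilon=-1$ if $q\equiv 2\pmod 3$. Let $B\subset\mathbb{P}^4$ be the Burkhardt quartic threefold over $\mathbb{F}_q$, defined by $$y_0(y_0^3+y_1^3+y_2^3+y_3^3+y_4^3)+3y_1y_2y_3y_4=0,$$ and let $$Z(B/\mathbb{F}_q,T)=\exp\left(\sum_{n=1}^\infty \#B(\mathbb{F}_{q^n})\frac{T^n}{n}\right)$$ be its zeta function, a formal power series in $T$ over $\mathbb{Q}$. Then $$Z(B/\mathbb{F}_q,T)=\frac{(1-qT)^{15}(1-\epsilon qT)^{14}}{(1-T)(1-q^2T)^{10}(1-\epsilon q^2T)^{6}(1-q^3T)}.$$ -/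

import Mathlib

open scoped LinearAlgebra.Projectivization PowerSeries

noncomputable section

/-- A closed algebraic set in projective `n`-space over `K`, given by a set of homogeneous
equations with coefficients in `K`. -/
structure ProjectiveAlgebraicSet (K : Type*) [Field K] (n : ℕ) where
  equations : Set (MvPolynomial (Fin (n + 1)) K)
  homogeneous : ∀ F ∈ equations, ∃ d : ℕ, F.IsHomogeneous d

namespace ProjectiveAlgebraicSet

/-- The set `X(L)` of `L`-rational points: the points of `ℙⁿ(L)` at which all equations vanish.
(Whether a homogeneous form vanishes does not depend on the representative, see
`mk_mem_points_iff`.) -/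
def points {K : Type*} [Field K] {n : ℕ} (X : ProjectiveAlgebraicSet K n)
    (L : Type*) [Field L] [Algebra K L] : Set (ℙ L (Fin (n + 1) → L)) :=
  {P | ∀ F ∈ X.equations, MvPolynomial.aeval P.rep F = 0}

theorem mk_mem_points_iff {K : Type*} [Field K] {n : ℕ} (X : ProjectiveAlgebraicSet K n)
    (L : Type*) [Field L] [Algebra K L] (v : Fin (n + 1) → L) (hv : v ≠ 0) :
    Projectivization.mk L v hv ∈ X.points L ↔
      ∀ F ∈ X.equations, MvPolynomial.aeval v F = 0 := by
  obtain ⟨a, ha⟩ := Projectivization.exists_smul_eq_mk_rep L v hv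
  have key : ∀ F ∈ X.equations,
      (MvPolynomial.aeval (Projectivization.mk L v hv).rep F = 0 ↔
        MvPolynomial.aeval v F = 0) := by
    intro F hF
    obtain ⟨d, hd⟩ := X.homogeneous F hF
    have h : MvPolynomial.aeval (Projectivization.mk L v hv).rep F =
        (a : L) ^ d * MvPolynomial.aeval v F := by
      rw [← ha, MvPolynomial.aeval_def, MvPolynomial.aeval_def, MvPolynomial.eval₂_eq',
        MvPolynomial.eval₂_eq', Finset.mul_sum]
      refine Finset.sum_congr rfl fun e he => ?_
      have hdeg : ∑ i, e i = d := by
        have h2 := hd (MvPolynomial.mem_support_iff.1 he)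
        rw [← h2, Finsupp.weight_apply, Finsupp.sum_fintype _ _ (by simp)]
        simp
      have hprod : ∏ i, (a • v) i ^ e i = (a : L) ^ d * ∏ i, v i ^ e i := by
        simp only [Pi.smul_apply, Units.smul_def, smul_eq_mul, mul_pow]
        rw [Finset.prod_mul_distrib, Finset.prod_pow_eq_pow_sum, hdeg]
      rw [hprod]
      ring
    rw [h]
    simp
  constructor
  · intro h F hF
    exact (key F hF).1 (h F hF)
  · intro h F hF
    exact (key F hF).2 (h F hF)

/-- For a finite field `K` and `n ≥ 1`, the number of points of `X` over the extension of `K` of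
degree `n` (which is unique up to isomorphism over `K`). -/
def pointCount {K : Type*} [Field K] [Finite K] {m : ℕ} (X : ProjectiveAlgebraicSet K m)
    (n : ℕ) [NeZero n] : ℕ :=
  haveI : Fact (ringChar K).Prime := ⟨CharP.char_is_prime K (ringChar K)⟩
  Nat.card (X.points (FiniteField.Extension K (ringChar K) n))

/-- The power series `∑_{n ≥ 1} #X(𝔽_{qⁿ}) Tⁿ / n`, where `K = 𝔽_q`. -/
def logZeta {K : Type*} [Field K] [Finite K] {m : ℕ} (X : ProjectiveAlgebraicSet K m) : ℚ⟦X⟧ :=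
  PowerSeries.mk fun n => match n with
    | 0 => 0
    | k + 1 => (X.pointCount (k + 1) : ℚ) / ((k + 1 : ℕ) : ℚ)

/-- The constant term of `logZeta` is zero, so that it may be substituted in a power series. -/
theorem hasSubst_logZeta {K : Type*} [Field K] [Finite K] {m : ℕ}
    (X : ProjectiveAlgebraicSet K m) : PowerSeries.HasSubst X.logZeta :=
  PowerSeries.HasSubst.of_constantCoeff_zero' (by
    rw [← PowerSeries.coeff_zero_eq_constantCoeff_apply, logZeta, PowerSeries.coeff_mk])

/-- The zeta function `Z(X/𝔽_q, T) = exp (∑_{n ≥ 1} #X(𝔽_{qⁿ}) Tⁿ / n)`, where `K = 𝔽_q`, as a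
formal power series in `T` with rational coefficients. -/
def zeta {K : Type*} [Field K] [Finite K] {m : ℕ} (X : ProjectiveAlgebraicSet K m) : ℚ⟦X⟧ :=
  (PowerSeries.exp ℚ).subst X.logZeta

end ProjectiveAlgebraicSet

/-- The quartic form `y₀ (y₀³ + y₁³ + y₂³ + y₃³ + y₄³) + 3 y₁ y₂ y₃ y₄`. -/
def burkhardtForm (K : Type*) [Field K] : MvPolynomial (Fin 5) K :=
  MvPolynomial.X 0 * (MvPolynomial.X 0 ^ 3 + MvPolynomial.X 1 ^ 3 + MvPolynomial.X 2 ^ 3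
      + MvPolynomial.X 3 ^ 3 + MvPolynomial.X 4 ^ 3)
    + 3 * MvPolynomial.X 1 * MvPolynomial.X 2 * MvPolynomial.X 3 * MvPolynomial.X 4

theorem burkhardtForm_isHomogeneous (K : Type*) [Field K] :
    (burkhardtForm K).IsHomogeneous 4 := by
  have hX : ∀ i : Fin 5, (MvPolynomial.X i : MvPolynomial (Fin 5) K).IsHomogeneous 1 :=
    fun i => MvPolynomial.isHomogeneous_X K i
  have hX3 : ∀ i : Fin 5, ((MvPolynomial.X i : MvPolynomial (Fin 5) K) ^ 3).IsHomogeneous 3 :=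
    fun i => (hX i).pow 3
  have h3 : (3 : MvPolynomial (Fin 5) K).IsHomogeneous 0 :=
    MvPolynomial.isHomogeneous_C (Fin 5) (3 : K)
  exact ((hX 0).mul (((((hX3 0).add (hX3 1)).add (hX3 2)).add (hX3 3)).add (hX3 4))).add
    ((((h3.mul (hX 1)).mul (hX 2)).mul (hX 3)).mul (hX 4))

/-- The Burkhardt quartic threefold in `ℙ⁴`. -/
def burkhardtQuartic (K : Type*) [Field K] : ProjectiveAlgebraicSet K 4 where
  equations := {burkhardtForm K}
  homogeneous := fun F hF => ⟨4, by
    rw [Set.mem_singleton_iff.1 hF]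
    exact burkhardtForm_isHomogeneous K⟩

end

/-!
The zeta function is computed by counting the points of the Burkhardt quartic over every finite
field `F` with `q` elements, `3 ∤ q`: with `s = 1` or `s = -1` according to `q` modulo `3`, there
are `q ^ 3 + (10 + 6 s) q ^ 2 - (15 + 14 s) q + 1` of them (`card_points_burkhardtQuartic`). Since
`s` is multiplicative in `q`, the logarithm of the zeta function is a combination of series
`-log (1 - c T)`, and exponentiating gives the claim.

The count is elementary. The hyperplane `y₀ = 0` meets the quartic in the four planes
`y₁ y₂ y₃ y₄ = 0`, so the chart `y₀ = 1` is what matters.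

* If `q ≡ 2 (mod 3)`, cubing is a bijection of `F`. With `zᵢ = yᵢ ^ 3` the equation becomes
  `z₀ (∑ zᵢ) ^ 3 + 27 z₁ z₂ z₃ z₄ = 0`. Taking `∑ zᵢ` as a coordinate and normalizing it to `1`
  leaves an equation linear in `z₄`; where the coefficient of `z₄` and the constant term both
  vanish, there is a nodal plane cubic, which is parametrized by lines through its node
  (`sum_indZero_burkhardt_of_cube_bijective`).
* If `q ≡ 1 (mod 3)`, let `w` be a primitive cube root of unity. On the chart with coordinates
  `b, c, d, e`, the factorization of `x ^ 3 + y ^ 3 + z ^ 3 - 3 x y z` into linear forms turns the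
  equation into `x y z = -(1 + d ^ 3) (1 + e ^ 3)` with `x + y + z = -3 d e`. For fixed `d` this is
  a cubic surface given by two trihedra, and `x = l (1 + e)`, `y = m (1 + w e)` is the parametrization
  coming from a pair of skew lines on it: the equation becomes linear in `e`. Its leading
  coefficient vanishes on a cubic surface with a double point, and both coefficients vanish on a
  union of lines (`sum_indZero_burkhardt_chart`).

All counts are written as sums of the indicator function `indZero` of zero, for which changes of
variables are reindexings and linear equations are solved by `sum_indZero_linear`.
-/

/-! ### Counting zeros with indicator sums -/

open Classical in
/-- The indicator of zero: `1` at `0` and `0` elsewhere. The number of zeros of a function `f` on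
a finite type is `∑ x, indZero (f x)`. -/
noncomputable def indZero {F : Type*} [Zero F] (x : F) : ℤ := if x = 0 then 1 else 0

section IndZero

theorem sum_rotate_five {F : Type*} [Fintype F] (f : F → F → F → F → F → ℤ) :
    ∑ a, ∑ b, ∑ c, ∑ d, ∑ e, f a b c d e = ∑ b, ∑ c, ∑ d, ∑ e, ∑ a, f a b c d e := by
  rw [Finset.sum_comm]
  refine Finset.sum_congr rfl fun b _ => ?_
  rw [Finset.sum_comm]
  refine Finset.sum_congr rfl fun c _ => ?_
  rw [Finset.sum_comm]
  refine Finset.sum_congr rfl fun d _ => ?_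
  rw [Finset.sum_comm]

variable {F : Type*} [Field F]

@[simp] theorem indZero_zero : indZero (0 : F) = 1 := by simp [indZero]

theorem indZero_of_ne {x : F} (hx : x ≠ 0) : indZero x = 0 := by simp [indZero, hx]

theorem indZero_congr {x y : F} (h : x = 0 ↔ y = 0) : indZero x = indZero y := by
  by_cases hx : x = 0
  · rw [hx, h.1 hx]
  · rw [indZero, indZero, if_neg hx, if_neg (mt h.2 hx)]

theorem indZero_mul (x y : F) :
    indZero (x * y) = indZero x + indZero y - indZero x * indZero y := by
  by_cases hx : x = 0 <;> by_cases hy : y = 0 <;> simp [indZero, hx, hy]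

theorem indZero_mul_left {a : F} (ha : a ≠ 0) (x : F) : indZero (a * x) = indZero x :=
  indZero_congr (by simp [ha])

variable [Fintype F]

theorem sum_indZero_sub_mul (a : F) (f : F → ℤ) : ∑ x, indZero (x - a) * f x = f a := by
  classical
  rw [Fintype.sum_eq_single a]
  · simp
  · intro x hx
    rw [indZero_of_ne (sub_ne_zero.2 hx), zero_mul]

theorem sum_indZero_mul (f : F → ℤ) : ∑ x, indZero x * f x = f 0 := by
  simpa using sum_indZero_sub_mul (0 : F) f

theorem sum_indZero_sub (a : F) : ∑ x, indZero (x - a) = 1 := by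
  simpa using sum_indZero_sub_mul a (fun _ => 1)

theorem sum_indZero : ∑ x : F, indZero x = 1 := by
  simpa using sum_indZero_sub (0 : F)

theorem sum_comp_mul_left {a : F} (ha : a ≠ 0) (f : F → ℤ) : ∑ x, f (a * x) = ∑ x, f x :=
  Equiv.sum_comp (Equiv.mulLeft₀ a ha) f

theorem sum_comp_add_left (a : F) (f : F → ℤ) : ∑ x, f (a + x) = ∑ x, f x :=
  Equiv.sum_comp (Equiv.addLeft a) f

/-- The number of solutions of `a x + b = 0`. -/
theorem sum_indZero_linear (a b : F) :
    ∑ x, indZero (a * x + b) =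
      1 - indZero a + Fintype.card F * (indZero a * indZero b) := by
  by_cases ha : a = 0
  · simp [ha]
  · have h : ∀ x, indZero (a * x + b) = indZero (x - (-b / a)) := fun x =>
      indZero_congr (by
        rw [← mul_right_inj' ha (b := x - -b / a) (c := 0)]
        field_simp
        simp)
    simp_rw [h, sum_indZero_sub, indZero_of_ne ha]
    simp

theorem sum_indZero_two_roots (a b : F) :
    ∑ x, indZero ((x - a) * (x - b)) = 2 - indZero (a - b) := by
  simp_rw [indZero_mul, Finset.sum_sub_distrib, Finset.sum_add_distrib, sum_indZero_sub,
    sum_indZero_sub_mul]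
  norm_num

theorem sum_indZero_three_roots {a b c : F} (hab : a ≠ b) (hac : a ≠ c) (hbc : b ≠ c) :
    ∑ x, indZero ((x - a) * (x - b) * (x - c)) = 3 := by
  have h : ∀ x, indZero ((x - a) * (x - b) * (x - c)) =
      indZero ((x - a) * (x - b)) + indZero (x - c) -
        indZero (x - c) * indZero ((x - a) * (x - b)) := fun x => by
    rw [indZero_mul]
    ring
  simp_rw [h, Finset.sum_sub_distrib, Finset.sum_add_distrib, sum_indZero_two_roots,
    sum_indZero_sub_mul, sum_indZero_sub]
  rw [indZero_of_ne (sub_ne_zero.2 hab),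
    indZero_of_ne (mul_ne_zero (sub_ne_zero.2 hac.symm) (sub_ne_zero.2 hbc.symm))]
  norm_num

theorem sum_eq_zero_add_of_const {g : F → ℤ} (h : ∀ a, a ≠ 0 → g a = g 1) :
    ∑ a, g a = g 0 + (Fintype.card F - 1) * g 1 := by
  have h' : ∀ a, g a = g 1 + indZero a * (g 0 - g 1) := fun a => by
    by_cases ha : a = 0
    · simp [ha]
    · rw [indZero_of_ne ha, h a ha]
      ring
  rw [Finset.sum_congr rfl fun a _ => h' a, Finset.sum_add_distrib,
    sum_indZero_mul (fun _ => g 0 - g 1)]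
  simp
  ring

/-- The affine zeros of a quartic form in five variables, split along the hyperplane where the
first variable vanishes. -/
theorem sum_indZero_quartic {f : F → F → F → F → F → F}
    (hf : ∀ t a b c d e, f (t * a) (t * b) (t * c) (t * d) (t * e) = t ^ 4 * f a b c d e) :
    ∑ a, ∑ b, ∑ c, ∑ d, ∑ e, indZero (f a b c d e) =
      (∑ b, ∑ c, ∑ d, ∑ e, indZero (f 0 b c d e)) +
        (Fintype.card F - 1) * ∑ b, ∑ c, ∑ d, ∑ e, indZero (f 1 b c d e) := by
  refine sum_eq_zero_add_of_const
    (g := fun a => ∑ b, ∑ c, ∑ d, ∑ e, indZero (f a b c d e)) fun a ha => ?_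
  rw [← sum_comp_mul_left ha]
  refine Finset.sum_congr rfl fun b _ => ?_
  rw [← sum_comp_mul_left ha]
  refine Finset.sum_congr rfl fun c _ => ?_
  rw [← sum_comp_mul_left ha]
  refine Finset.sum_congr rfl fun d _ => ?_
  rw [← sum_comp_mul_left ha]
  refine Finset.sum_congr rfl fun e _ => ?_
  rw [← indZero_mul_left (pow_ne_zero 4 ha) (f 1 b c d e), ← hf, mul_one]

theorem sum_indZero_mul_two :
    ∑ x : F, ∑ y : F, indZero (x * y) = 2 * Fintype.card F - 1 := by
  simp_rw [indZero_mul, Finset.sum_sub_distrib, Finset.sum_add_distrib, ← Finset.mul_sum,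
    sum_indZero]
  simp [sum_indZero, ← Finset.mul_sum]
  ring

/-- The number of `(b, c, d, e)` with `k b c d e = 0`. -/
theorem sum_indZero_mul_four {k : F} (hk : k ≠ 0) :
    ∑ b : F, ∑ c : F, ∑ d : F, ∑ e : F, indZero (k * b * c * d * e) =
      (Fintype.card F : ℤ) ^ 4 - (Fintype.card F - 1) ^ 4 := by
  have h : ∀ b c d e : F, indZero (k * b * c * d * e) =
      1 - (1 - indZero b) * ((1 - indZero c) * ((1 - indZero d) * (1 - indZero e))) := by
    intro b c d e
    simp only [indZero_mul, indZero_of_ne hk]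
    ring
  simp_rw [h, Finset.sum_sub_distrib, ← Finset.mul_sum, Finset.sum_sub_distrib, sum_indZero,
    ← Finset.sum_mul, Finset.sum_sub_distrib, sum_indZero]
  simp
  ring

end IndZero

/-! ### The count when cubing is bijective -/

section CubingBijective

variable {F : Type*} [Field F] [Fintype F]

/-- The number of `(b, c)` with `b c (1 - b - c) = 1 / 27`. This nodal cubic has its node at
`b = c = 1 / 3`, with tangent cone `u ^ 2 + u v + v ^ 2 = 0`; it is parametrized by the slope of the
line through the node. -/
theorem sum_indZero_nodal_cubic (h3 : (3 : F) ≠ 0)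
    (hnorm : ∀ u v : F, u ^ 2 + u * v + v ^ 2 = 0 → v = 0) :
    ∑ b : F, ∑ c : F, indZero (27 * b * c * (1 - b - c) - 1) = (Fintype.card F : ℤ) - 1 := by
  have hshift : ∀ f : F → ℤ, ∑ b, f b = ∑ u, f (3⁻¹ * (1 + u)) := fun f => by
    rw [sum_comp_add_left 1 (fun u => f (3⁻¹ * u)), sum_comp_mul_left (inv_ne_zero h3)]
  have hpoly : ∀ u v : F, indZero (27 * (3⁻¹ * (1 + u)) * (3⁻¹ * (1 + v)) *
        (1 - 3⁻¹ * (1 + u) - 3⁻¹ * (1 + v)) - 1) =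
      indZero (u ^ 2 + u * v + v ^ 2 + u * v * (u + v)) := fun u v => by
    rw [← indZero_mul_left (neg_ne_zero.2 one_ne_zero)]
    congr 1
    field_simp
    ring
  -- The points with `v ≠ 0`, in the coordinates `k = u / v` and `v`.
  have hslope : ∀ v : F, ∑ u, indZero (u ^ 2 + u * v + v ^ 2 + u * v * (u + v)) =
      indZero v + ∑ k, (indZero (k * (k + 1) * v + (k ^ 2 + k + 1)) -
        indZero v * indZero (k * (k + 1) * v + (k ^ 2 + k + 1))) := fun v => by
    by_cases hv : v = 0
    · subst hv
      simp only [mul_zero, add_zero, zero_add, indZero_zero, one_mul, sub_self, zero_mul,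
        ne_eq, OfNat.ofNat_ne_zero, not_false_eq_true, zero_pow, Finset.sum_const_zero]
      rw [← sum_indZero (F := F)]
      exact Finset.sum_congr rfl fun u _ => indZero_congr (by simp)
    · rw [indZero_of_ne hv, ← sum_comp_mul_left hv]
      simp only [zero_mul, sub_zero, zero_add]
      refine Finset.sum_congr rfl fun k _ => ?_
      rw [← indZero_mul_left (pow_ne_zero 2 hv) (k * (k + 1) * v + _)]
      congr 1
      ring
  have hk : ∀ k : F, k ^ 2 + k + 1 ≠ 0 := fun k hk => by
    simpa using hnorm k 1 (by linear_combination hk)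
  rw [hshift]
  simp_rw [hshift (fun c => indZero (27 * _ * c * (1 - _ - c) - 1)), hpoly]
  rw [Finset.sum_comm]
  simp_rw [hslope]
  rw [Finset.sum_add_distrib, sum_indZero, Finset.sum_comm]
  simp_rw [Finset.sum_sub_distrib, sum_indZero_mul, sum_indZero_linear, mul_zero, zero_add,
    indZero_of_ne (hk _), mul_zero, add_zero, Finset.sum_sub_distrib]
  have h2 := sum_indZero_two_roots (0 : F) (-1)
  simp only [sub_zero, sub_neg_eq_add, zero_add, indZero_of_ne one_ne_zero] at h2
  rw [h2]
  simp
  ring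

/-- The number of zeros of `1 - b - c - d - e + 27 b c d e`, an equation linear in `e`. -/
theorem sum_indZero_linear_model (h3 : (3 : F) ≠ 0)
    (hnorm : ∀ u v : F, u ^ 2 + u * v + v ^ 2 = 0 → v = 0) :
    ∑ b : F, ∑ c : F, ∑ d : F, ∑ e : F,
        indZero ((1 - b - c - d - e) * 1 ^ 3 + 27 * b * c * d * e) =
      (Fintype.card F : ℤ) ^ 3 + Fintype.card F - 1 := by
  have h27 : (27 : F) ≠ 0 := by
    have : (27 : F) = 3 ^ 3 := by norm_num
    rw [this]
    exact pow_ne_zero 3 h3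
  have he : ∀ b c d e : F, (1 - b - c - d - e) * 1 ^ 3 + 27 * b * c * d * e =
      (27 * b * c * d + -1) * e + (1 - b - c - d) := fun b c d e => by ring
  have hcoef : ∀ b c : F, ∑ d, indZero (27 * b * c * d + -1) = 1 - indZero (b * c) :=
    fun b c => by
      rw [sum_indZero_linear, indZero_of_ne (x := (-1 : F)) (by simp), mul_assoc,
        indZero_mul_left h27]
      ring
  have hboth : ∀ b c : F,
      ∑ d, indZero (27 * b * c * d + -1) * indZero (1 - b - c - d) =
        indZero (27 * b * c * (1 - b - c) - 1) := fun b c => by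
    rw [sub_eq_add_neg (27 * b * c * (1 - b - c)), ← sum_indZero_sub_mul (1 - b - c)
      (fun d => indZero (27 * b * c * d + -1))]
    refine Finset.sum_congr rfl fun d _ => ?_
    rw [mul_comm, ← indZero_mul_left (neg_ne_zero.2 one_ne_zero) (1 - b - c - d)]
    congr 2
    ring
  simp_rw [he, sum_indZero_linear, Finset.sum_add_distrib, Finset.sum_sub_distrib, hcoef,
    ← Finset.mul_sum, hboth, sum_indZero_nodal_cubic h3 hnorm, Finset.sum_sub_distrib,
    sum_indZero_mul_two]
  simp
  ring

/-- If cubing is bijective, then replacing the coordinates by their cubes and the first one by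
the sum `w` of all cubes turns the Burkhardt equation into
`(w - b - c - d - e) w ^ 3 + 27 b c d e = 0`, which is linear in `e` where `w = 1`. -/
theorem sum_indZero_burkhardt_of_cube_bijective (h3 : (3 : F) ≠ 0)
    (hcube : Function.Bijective fun x : F => x ^ 3)
    (hnorm : ∀ u v : F, u ^ 2 + u * v + v ^ 2 = 0 → v = 0) :
    ∑ a : F, ∑ b : F, ∑ c : F, ∑ d : F, ∑ e : F,
        indZero (a * (a ^ 3 + b ^ 3 + c ^ 3 + d ^ 3 + e ^ 3) + 3 * b * c * d * e) =
      (Fintype.card F : ℤ) ^ 4 - (Fintype.card F - 1) ^ 4 +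
        (Fintype.card F - 1) * ((Fintype.card F : ℤ) ^ 3 + Fintype.card F - 1) := by
  have h27 : (27 : F) ≠ 0 := by
    have : (27 : F) = 3 ^ 3 := by norm_num
    rw [this]
    exact pow_ne_zero 3 h3
  have hcubes : ∀ a b c d e : F,
      indZero (a * (a ^ 3 + b ^ 3 + c ^ 3 + d ^ 3 + e ^ 3) + 3 * b * c * d * e) =
        indZero (a ^ 3 * (a ^ 3 + b ^ 3 + c ^ 3 + d ^ 3 + e ^ 3) ^ 3 +
          27 * b ^ 3 * c ^ 3 * d ^ 3 * e ^ 3) := fun a b c d e => indZero_congr (by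
    rw [add_eq_zero_iff_eq_neg, add_eq_zero_iff_eq_neg, ← hcube.injective.eq_iff]
    constructor <;> intro h <;> linear_combination h)
  have hsub : ∀ f : F → ℤ, ∑ x, f (x ^ 3) = ∑ x, f x := fun f => hcube.sum_comp f
  have hz : ∑ a : F, ∑ b : F, ∑ c : F, ∑ d : F, ∑ e : F,
        indZero (a * (a + b + c + d + e) ^ 3 + 27 * b * c * d * e) =
      ∑ a : F, ∑ b : F, ∑ c : F, ∑ d : F, ∑ e : F,
        indZero (a * (a ^ 3 + b ^ 3 + c ^ 3 + d ^ 3 + e ^ 3) + 3 * b * c * d * e) := by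
    rw [← hsub]
    refine Finset.sum_congr rfl fun a _ => ?_
    rw [← hsub]
    refine Finset.sum_congr rfl fun b _ => ?_
    rw [← hsub]
    refine Finset.sum_congr rfl fun c _ => ?_
    rw [← hsub]
    refine Finset.sum_congr rfl fun d _ => ?_
    rw [← hsub]
    exact Finset.sum_congr rfl fun e _ => (hcubes a b c d e).symm
  have hw : ∑ a : F, ∑ b : F, ∑ c : F, ∑ d : F, ∑ e : F, indZero
        (a * (a + b + c + d + e) ^ 3 + 27 * b * c * d * e) =
      ∑ w : F, ∑ b : F, ∑ c : F, ∑ d : F, ∑ e : F, indZero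
        ((w - b - c - d - e) * w ^ 3 + 27 * b * c * d * e) := by
    rw [sum_rotate_five, sum_rotate_five (f := fun w b c d e => indZero
      ((w - b - c - d - e) * w ^ 3 + 27 * b * c * d * e))]
    refine Finset.sum_congr rfl fun b _ => Finset.sum_congr rfl fun c _ =>
      Finset.sum_congr rfl fun d _ => Finset.sum_congr rfl fun e _ => ?_
    rw [← sum_comp_add_left (b + c + d + e) fun w =>
      indZero ((w - b - c - d - e) * w ^ 3 + 27 * b * c * d * e)]
    refine Finset.sum_congr rfl fun a _ => ?_
    congr 1
    ring
  rw [← hz, hw, sum_indZero_quartic (f := fun w b c d e => (w - b - c - d - e) * w ^ 3 +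
    27 * b * c * d * e) (fun t a b c d e => by ring), sum_indZero_linear_model h3 hnorm]
  simp only [ne_eq, OfNat.ofNat_ne_zero, not_false_eq_true, zero_pow, mul_zero, zero_add]
  rw [sum_indZero_mul_four h27]

end CubingBijective

/-! ### The count when there is a primitive cube root of unity -/

section CubeRootOfUnity

variable {F : Type*} [Field F] {w : F}

theorem omega_ne_zero (hw : w ^ 2 + w + 1 = 0) : w ≠ 0 := by
  rintro rfl
  simp at hw

theorem omega_cube (hw : w ^ 2 + w + 1 = 0) : w ^ 3 = 1 := by
  linear_combination (w - 1) * hw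

theorem one_sub_omega_ne_zero (h3 : (3 : F) ≠ 0) (hw : w ^ 2 + w + 1 = 0) : 1 - w ≠ 0 := by
  intro h
  apply h3
  linear_combination hw + (w + 2) * h

theorem one_sub_omega_sq_ne_zero (h3 : (3 : F) ≠ 0) (hw : w ^ 2 + w + 1 = 0) :
    1 - w ^ 2 ≠ 0 := by
  intro h
  apply h3
  linear_combination (2 - w) * hw + (1 - w) * h

theorem omega_sub_omega_sq_ne_zero (h3 : (3 : F) ≠ 0) (hw : w ^ 2 + w + 1 = 0) :
    w - w ^ 2 ≠ 0 := by
  have := mul_ne_zero (omega_ne_zero hw) (one_sub_omega_ne_zero h3 hw)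
  intro h
  apply this
  linear_combination h

theorem indZero_mul_indZero_one_add_cube (c : F) : indZero c * indZero (1 + c ^ 3) = 0 := by
  by_cases hc : c = 0
  · simp [hc, indZero_of_ne]
  · rw [indZero_of_ne hc, zero_mul]

theorem burkhardt_chart_identity (hw : w ^ 2 + w + 1 = 0) (b c d e : F) :
    1 * (1 ^ 3 + b ^ 3 + c ^ 3 + d ^ 3 + e ^ 3) + 3 * b * c * d * e =
      (b + c - d * e) * (w * b + w ^ 2 * c - d * e) *
          (-3 * d * e - (b + c - d * e) - (w * b + w ^ 2 * c - d * e)) +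
        (1 + d ^ 3) * (1 + e ^ 3) := by
  grind

variable [Fintype F]

theorem sum_indZero_cube_sub_cube (h3 : (3 : F) ≠ 0) (hw : w ^ 2 + w + 1 = 0) {t : F}
    (ht : t ≠ 0) (s : F) : ∑ x, indZero ((x - s) ^ 3 - t ^ 3) = 3 := by
  have h : ∀ x, (x - s) ^ 3 - t ^ 3 =
      (x - (s + t)) * (x - (s + w * t)) * (x - (s + w ^ 2 * t)) := fun x => by
    linear_combination (-(x - s) * t ^ 2 * w + t ^ 3 * (w - 1) + (x - s) ^ 2 * t) * hw
  simp_rw [h]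
  refine sum_indZero_three_roots ?_ ?_ ?_
  · intro h
    exact mul_ne_zero (one_sub_omega_ne_zero h3 hw) ht (by linear_combination h)
  · intro h
    exact mul_ne_zero (one_sub_omega_sq_ne_zero h3 hw) ht (by linear_combination h)
  · intro h
    exact mul_ne_zero (omega_sub_omega_sq_ne_zero h3 hw) ht (by linear_combination h)

theorem sum_indZero_one_add_cube (h3 : (3 : F) ≠ 0) (hw : w ^ 2 + w + 1 = 0) :
    ∑ x : F, indZero (1 + x ^ 3) = 3 := by
  rw [← sum_indZero_cube_sub_cube h3 hw (neg_ne_zero.2 (one_ne_zero (α := F))) 0]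
  refine Finset.sum_congr rfl fun x _ => ?_
  congr 1
  ring

/-- The number of `(x, y, c)` with `x y (k c - x - y) = 0`. -/
theorem sum_indZero_three_lines {k : F} (hk : k ≠ 0) :
    ∑ c : F, ∑ x : F, ∑ y : F, indZero (x * y * (k * c - x - y)) =
      3 * (Fintype.card F : ℤ) ^ 2 - 3 * Fintype.card F + 1 := by
  have hy : ∀ c x : F, ∑ y, indZero (x * y * (k * c - x - y)) =
      2 - indZero (k * c - x) + indZero x * (Fintype.card F - 2 + indZero (k * c - x)) := by
    intro c x
    by_cases hx : x = 0
    · simp [hx]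
    · have h : ∀ y, indZero (x * y * (k * c - x - y)) =
          indZero ((y - 0) * (y - (k * c - x))) := fun y => by
        rw [← indZero_mul_left (neg_ne_zero.2 hx) ((y - 0) * _)]
        congr 1
        ring
      simp_rw [h, sum_indZero_two_roots, indZero_of_ne hx, zero_sub, zero_mul, add_zero]
      congr 1
      exact indZero_congr neg_eq_zero
  have hneg : ∀ c : F, ∑ x, indZero (k * c - x) = 1 := fun c => by
    rw [← sum_indZero_sub (k * c)]
    exact Finset.sum_congr rfl fun x _ => indZero_congr (by rw [sub_eq_zero, sub_eq_zero, eq_comm])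
  simp_rw [hy, Finset.sum_add_distrib, Finset.sum_sub_distrib,
    sum_indZero_mul (fun x => _ - _ + indZero (_ - x)), hneg, sub_zero, indZero_mul_left hk,
    Finset.sum_add_distrib, sum_indZero]
  simp
  ring

/-- The number of `(c, y, x)` with `x y (u c - v y) + r (1 + c ^ 3) = 0`, an equation linear in
`x`. -/
theorem sum_indZero_exceptional (h3 : (3 : F) ≠ 0) (hw : w ^ 2 + w + 1 = 0) {u v r : F}
    (hu : u ≠ 0) (hv : v ≠ 0) (hr : r ≠ 0) :
    ∑ c : F, ∑ y : F, ∑ x : F, indZero (y * (u * c - v * y) * x + r * (1 + c ^ 3)) =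
      (Fintype.card F : ℤ) ^ 2 + 4 * Fintype.card F + 1 := by
  have hcoef : ∀ c : F, ∑ y, indZero (y * (u * c - v * y)) = 2 - indZero c := by
    intro c
    have h : ∀ y, indZero (y * (u * c - v * y)) = indZero ((y - 0) * (y - u * c / v)) :=
      fun y => by
        rw [← indZero_mul_left (neg_ne_zero.2 hv) ((y - 0) * _)]
        congr 1
        field_simp
        ring
    simp_rw [h, sum_indZero_two_roots]
    congr 1
    exact indZero_congr (by simp [hu, hv])
  simp_rw [sum_indZero_linear, indZero_mul_left hr, Finset.sum_add_distrib,
    Finset.sum_sub_distrib, ← Finset.mul_sum, ← Finset.sum_mul, hcoef, sub_mul,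
    indZero_mul_indZero_one_add_cube, sub_zero, ← Finset.mul_sum,
    sum_indZero_one_add_cube h3 hw, Finset.sum_sub_distrib, sum_indZero]
  simp
  ring

/-- The number of `(c, l, m)` with `1 + c ^ 3 - 3 w c l m - w l ^ 2 m - w ^ 2 l m ^ 2 = 0`. The
closure of this cubic surface has a double point at infinity, and projecting from it makes the
equation linear. -/
theorem sum_indZero_singular_cubic_surface (h3 : (3 : F) ≠ 0) (hw : w ^ 2 + w + 1 = 0) :
    ∑ c : F, ∑ l : F, ∑ m : F,
        indZero (1 + c ^ 3 - 3 * w * c * l * m - w * l ^ 2 * m - w ^ 2 * l * m ^ 2) =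
      (Fintype.card F : ℤ) ^ 2 + 4 * Fintype.card F + 1 := by
  have hw3 := omega_cube hw
  have hw2 : w ^ 2 ≠ 0 := pow_ne_zero 2 (omega_ne_zero hw)
  -- With `c = g - l` and `m = w ^ 2 (l + n)`, the double point lies in the direction of `l`.
  have hchange : ∑ c : F, ∑ l : F, ∑ m : F,
        indZero (1 + c ^ 3 - 3 * w * c * l * m - w * l ^ 2 * m - w ^ 2 * l * m ^ 2) =
      ∑ g : F, ∑ n : F, ∑ l : F,
        indZero ((n - (w - 1) * g) * (n - (w ^ 2 - 1) * g) * l + -(1 + g ^ 3)) := by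
    rw [Finset.sum_comm]
    conv_rhs =>
      enter [2, g]
      rw [Finset.sum_comm]
    conv_rhs => rw [Finset.sum_comm]
    refine Finset.sum_congr rfl fun l _ => ?_
    rw [← sum_comp_add_left (-l)]
    refine Finset.sum_congr rfl fun g _ => ?_
    rw [← sum_comp_mul_left hw2, ← sum_comp_add_left l]
    refine Finset.sum_congr rfl fun n _ => ?_
    rw [← indZero_mul_left (neg_ne_zero.2 one_ne_zero)]
    congr 1
    grind
  have hcoef : ∀ g : F, ∑ n, indZero ((n - (w - 1) * g) * (n - (w ^ 2 - 1) * g)) =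
      2 - indZero g := by
    intro g
    rw [sum_indZero_two_roots, ← sub_mul, indZero_mul_left]
    intro h
    apply omega_sub_omega_sq_ne_zero h3 hw
    linear_combination h
  have hneg : ∀ x : F, indZero (-x) = indZero x := fun x => indZero_congr neg_eq_zero
  simp_rw [hchange, sum_indZero_linear, hneg, Finset.sum_add_distrib,
    Finset.sum_sub_distrib, ← Finset.mul_sum, ← Finset.sum_mul, hcoef, sub_mul,
    indZero_mul_indZero_one_add_cube, sub_zero, ← Finset.mul_sum,
    sum_indZero_one_add_cube h3 hw, Finset.sum_sub_distrib, sum_indZero]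
  simp
  ring

/-- The number of `(c, l, m)` at which both coefficients of the equation linear in `e`
(with `c` in place of `d`) in `sum_indZero_burkhardt_chart` vanish.
Where `l m ≠ 0`, the two conditions amount to a linear equation for `c` together with
`(l - w m) ^ 3 = (w - w ^ 2) ^ 3`. -/
theorem sum_indZero_both_coefficients (h3 : (3 : F) ≠ 0) (hw : w ^ 2 + w + 1 = 0) :
    ∑ c : F, ∑ l : F, ∑ m : F,
        indZero (1 + c ^ 3 - 3 * w * c * l * m - w * l ^ 2 * m - w ^ 2 * l * m ^ 2) *
          indZero (1 + c ^ 3 - l * m * (l + m)) =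
      9 * (Fintype.card F : ℤ) - 9 := by
  have hw3 := omega_cube hw
  have hw0 := omega_ne_zero hw
  have ht := omega_sub_omega_sq_ne_zero h3 hw
  have h3w : 3 * w ≠ 0 := mul_ne_zero h3 hw0
  have hpt : ∀ c l m : F,
      indZero (1 + c ^ 3 - 3 * w * c * l * m - w * l ^ 2 * m - w ^ 2 * l * m ^ 2) *
          indZero (1 + c ^ 3 - l * m * (l + m)) =
        indZero (1 + c ^ 3) * indZero (l * m) +
          indZero (3 * w * c + ((w - 1) * l + (w ^ 2 - 1) * m)) *
            (indZero ((l - w * m) ^ 3 - (w - w ^ 2) ^ 3) -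
              indZero (l * m) * indZero ((l - w * m) ^ 3 - (w - w ^ 2) ^ 3)) := by
    intro c l m
    by_cases hlm : l * m = 0
    · have e1 : 1 + c ^ 3 - 3 * w * c * l * m - w * l ^ 2 * m - w ^ 2 * l * m ^ 2 = 1 + c ^ 3 := by
        linear_combination (-3 * w * c - w * l - w ^ 2 * m) * hlm
      have e2 : 1 + c ^ 3 - l * m * (l + m) = 1 + c ^ 3 := by
        linear_combination (-(l + m)) * hlm
      rw [e1, e2, hlm]
      by_cases hc : 1 + c ^ 3 = 0
      · simp [hc]
      · simp [indZero_of_ne hc]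
    · rw [indZero_of_ne hlm, mul_zero, zero_mul, zero_add, sub_zero]
      by_cases hc : 3 * w * c + ((w - 1) * l + (w ^ 2 - 1) * m) = 0
      · have hB : 1 + c ^ 3 - 3 * w * c * l * m - w * l ^ 2 * m - w ^ 2 * l * m ^ 2 =
            1 + c ^ 3 - l * m * (l + m) := by
          linear_combination (-(l * m)) * hc
        have hc' : (w - w ^ 2) * c = m - w * l := mul_left_cancel₀ ht (by grind)
        have hcube : (w - w ^ 2) ^ 3 * c ^ 3 = (m - w * l) ^ 3 := by rw [← mul_pow, hc']
        have hline : (w - w ^ 2) ^ 3 * (1 + c ^ 3 - l * m * (l + m)) =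
            -((l - w * m) ^ 3 - (w - w ^ 2) ^ 3) := by
          grind
        have hsq : ∀ x : F, indZero x * indZero x = indZero x := fun x => by
          by_cases hx : x = 0
          · simp [hx]
          · simp [indZero_of_ne hx]
        rw [hB, hsq, hc, indZero_zero, one_mul, ← indZero_mul_left (pow_ne_zero 3 ht), hline]
        exact indZero_congr neg_eq_zero
      · rw [indZero_of_ne hc, zero_mul]
        by_cases hB : 1 + c ^ 3 - l * m * (l + m) = 0
        · rw [indZero_of_ne, zero_mul]
          intro hA
          refine mul_ne_zero hlm hc ?_
          linear_combination hB - hA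
        · rw [indZero_of_ne hB, mul_zero]
  have hsum_c : ∀ l m : F, ∑ c, indZero (3 * w * c + ((w - 1) * l + (w ^ 2 - 1) * m)) = 1 :=
    fun l m => by
      rw [sum_indZero_linear, indZero_of_ne h3w]
      ring
  have hl : ∀ m : F, ∑ l, indZero ((l - w * m) ^ 3 - (w - w ^ 2) ^ 3) = 3 := fun m =>
    sum_indZero_cube_sub_cube h3 hw ht (w * m)
  have hm0 : ∑ m : F, indZero ((0 - w * m) ^ 3 - (w - w ^ 2) ^ 3) = 3 := by
    rw [← sum_indZero_cube_sub_cube h3 hw (neg_ne_zero.2 ht) 0]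
    refine Finset.sum_congr rfl fun m _ => ?_
    rw [← indZero_mul_left (neg_ne_zero.2 one_ne_zero) ((m - 0) ^ 3 - _)]
    congr 1
    linear_combination (-m ^ 3) * hw3
  have hlm : ∑ l : F, ∑ m : F,
      indZero (l * m) * indZero ((l - w * m) ^ 3 - (w - w ^ 2) ^ 3) = 6 := by
    have h00 : indZero ((0 - w * 0) ^ 3 - (w - w ^ 2) ^ 3) = 0 :=
      indZero_of_ne (by simpa using ht)
    simp_rw [indZero_mul, sub_mul, add_mul, Finset.sum_sub_distrib, Finset.sum_add_distrib,
      mul_assoc, ← Finset.mul_sum]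
    rw [sum_indZero_mul (fun l => ∑ m, indZero ((l - w * m) ^ 3 - (w - w ^ 2) ^ 3)), hm0,
      sum_indZero_mul (fun l => ∑ m, indZero m * indZero ((l - w * m) ^ 3 - (w - w ^ 2) ^ 3)),
      Finset.sum_comm]
    simp_rw [← Finset.mul_sum]
    rw [sum_indZero_mul (fun m => ∑ l, indZero ((l - w * m) ^ 3 - (w - w ^ 2) ^ 3)), hl,
      sum_indZero_mul (fun m => indZero ((0 - w * m) ^ 3 - (w - w ^ 2) ^ 3)), h00]
    norm_num
  have hlin : ∑ c : F, ∑ l : F, ∑ m : F,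
      indZero (3 * w * c + ((w - 1) * l + (w ^ 2 - 1) * m)) *
            (indZero ((l - w * m) ^ 3 - (w - w ^ 2) ^ 3) -
              indZero (l * m) * indZero ((l - w * m) ^ 3 - (w - w ^ 2) ^ 3)) =
      3 * (Fintype.card F : ℤ) - 6 := by
    rw [Finset.sum_comm]
    conv_lhs =>
      enter [2, l]
      rw [Finset.sum_comm]
    simp_rw [← Finset.sum_mul, hsum_c, one_mul, Finset.sum_sub_distrib, hlm]
    rw [Finset.sum_comm]
    simp_rw [hl]
    simp
    ring
  simp_rw [hpt, Finset.sum_add_distrib, ← Finset.mul_sum, ← Finset.sum_mul, hlin,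
    sum_indZero_one_add_cube h3 hw, sum_indZero_mul_two]
  ring

/-- The number of points in the chart `a = 1`. With `x = b + c - d e` and
`y = w b + w ^ 2 c - d e` the equation becomes
`x y (-3 d e - x - y) = -(1 + d ^ 3) (1 + e ^ 3)`. Putting `x = l (1 + e)` and `y = m (1 + w e)`
and cancelling the two factors makes it linear in `e`. -/
theorem sum_indZero_burkhardt_chart (h3 : (3 : F) ≠ 0) (hw : w ^ 2 + w + 1 = 0) :
    ∑ b : F, ∑ c : F, ∑ d : F, ∑ e : F,
        indZero (1 * (1 ^ 3 + b ^ 3 + c ^ 3 + d ^ 3 + e ^ 3) + 3 * b * c * d * e) =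
      (Fintype.card F : ℤ) ^ 3 + 12 * (Fintype.card F : ℤ) ^ 2 - 27 * Fintype.card F - 1 := by
  have hw3 := omega_cube hw
  have hw0 := omega_ne_zero hw
  have hw1 := one_sub_omega_ne_zero h3 hw
  have hw2 := one_sub_omega_sq_ne_zero h3 hw
  -- `S d e` counts the `(x, y)`, and `T d e` the `(l, m)`.
  set S : F → F → ℤ := fun d e =>
    ∑ x, ∑ y, indZero (x * y * (-3 * d * e - x - y) + (1 + d ^ 3) * (1 + e ^ 3)) with hS
  set T : F → F → ℤ := fun d e =>
    ∑ l, ∑ m, indZero (l * m * (-3 * d * e - l * (1 + e) - m * (1 + w * e)) +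
      (1 + d ^ 3) * (1 + w ^ 2 * e)) with hT
  have hxy : ∑ b : F, ∑ c : F, ∑ d : F, ∑ e : F,
      indZero (1 * (1 ^ 3 + b ^ 3 + c ^ 3 + d ^ 3 + e ^ 3) + 3 * b * c * d * e) =
        ∑ d, ∑ e, S d e := by
    have hcomm : ∀ f : F → F → F → F → ℤ,
        ∑ b, ∑ c, ∑ d, ∑ e, f b c d e = ∑ d, ∑ e, ∑ p : F × F, f p.1 p.2 d e := fun f => by
      rw [← Fintype.sum_prod_type' fun b c => ∑ d, ∑ e, f b c d e, Finset.sum_comm]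
      exact Finset.sum_congr rfl fun d _ => Finset.sum_comm
    rw [hcomm]
    refine Finset.sum_congr rfl fun d _ => Finset.sum_congr rfl fun e _ => ?_
    rw [hS]
    dsimp only
    rw [← Fintype.sum_prod_type' fun x y =>
      indZero (x * y * (-3 * d * e - x - y) + (1 + d ^ 3) * (1 + e ^ 3))]
    have hinj : Function.Injective fun p : F × F =>
        (p.1 + p.2 - d * e, w * p.1 + w ^ 2 * p.2 - d * e) := by
      rintro ⟨b, c⟩ ⟨b', c'⟩ h
      simp only [Prod.mk.injEq] at h
      have hc : c = c' := mul_left_cancel₀ (omega_sub_omega_sq_ne_zero h3 hw)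
        (by linear_combination w * h.1 - h.2)
      exact Prod.ext (by linear_combination h.1 - hc) hc
    refine Eq.trans (Finset.sum_congr rfl fun p _ => ?_)
      ((Finite.injective_iff_bijective.1 hinj).sum_comp _)
    congr 1
    exact burkhardt_chart_identity hw p.1 p.2 d e
  -- For `e = -1` and `e = -w ^ 2` the substitution degenerates; these are counted separately.
  have hST : ∀ d e, 1 + e ≠ 0 → 1 + w * e ≠ 0 → S d e = T d e := by
    intro d e h1 h2
    rw [hS, hT]
    dsimp only
    rw [← sum_comp_mul_left h1]
    refine Finset.sum_congr rfl fun l _ => ?_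
    rw [← sum_comp_mul_left h2]
    refine Finset.sum_congr rfl fun m _ => ?_
    rw [← indZero_mul_left (mul_ne_zero h1 h2) (l * m * _ + _)]
    congr 1
    grind
  have hsplit : ∀ d, ∑ e, S d e =
      ∑ e, T d e + (S d (-1) - T d (-1)) + (S d (-w ^ 2) - T d (-w ^ 2)) := by
    intro d
    have h := Fintype.sum_eq_add (f := fun e => S d e - T d e) (-1) (-w ^ 2)
      (fun h => hw2 (by linear_combination -h)) (fun e he => sub_eq_zero.2 (hST d e
        (fun h => he.1 (by linear_combination h))
        (fun h => he.2 (by linear_combination w ^ 2 * h - e * hw3))))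
    rw [Finset.sum_sub_distrib] at h
    linarith
  have hS1 : ∑ d, S d (-1) = 3 * (Fintype.card F : ℤ) ^ 2 - 3 * Fintype.card F + 1 := by
    rw [← sum_indZero_three_lines h3]
    refine Finset.sum_congr rfl fun d _ => Finset.sum_congr rfl fun x _ =>
      Finset.sum_congr rfl fun y _ => ?_
    congr 1
    ring
  have hS2 : ∑ d, S d (-w ^ 2) = 3 * (Fintype.card F : ℤ) ^ 2 - 3 * Fintype.card F + 1 := by
    rw [← sum_indZero_three_lines (mul_ne_zero h3 (pow_ne_zero 2 hw0))]
    refine Finset.sum_congr rfl fun d _ => Finset.sum_congr rfl fun x _ =>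
      Finset.sum_congr rfl fun y _ => ?_
    congr 1
    grind
  have hT1 : ∑ d, T d (-1) = (Fintype.card F : ℤ) ^ 2 + 4 * Fintype.card F + 1 := by
    rw [← sum_indZero_exceptional h3 hw h3 hw1 hw2]
    refine Finset.sum_congr rfl fun d _ => ?_
    rw [hT]
    dsimp only
    rw [Finset.sum_comm]
    refine Finset.sum_congr rfl fun m _ => Finset.sum_congr rfl fun l _ => ?_
    congr 1
    ring
  have hT2 : ∑ d, T d (-w ^ 2) = (Fintype.card F : ℤ) ^ 2 + 4 * Fintype.card F + 1 := by
    rw [← sum_indZero_exceptional h3 hw (mul_ne_zero h3 (pow_ne_zero 2 hw0)) hw2 hw1]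
    refine Finset.sum_congr rfl fun d _ => Finset.sum_congr rfl fun l _ =>
      Finset.sum_congr rfl fun m _ => ?_
    congr 1
    grind
  have hT3 : ∑ d, ∑ e, T d e =
      (Fintype.card F : ℤ) ^ 3 + 8 * (Fintype.card F : ℤ) ^ 2 - 13 * Fintype.card F - 1 := by
    have he : ∀ d l m e : F, indZero (l * m * (-3 * d * e - l * (1 + e) - m * (1 + w * e)) +
        (1 + d ^ 3) * (1 + w ^ 2 * e)) =
        indZero (w ^ 2 * (1 + d ^ 3 - 3 * w * d * l * m - w * l ^ 2 * m - w ^ 2 * l * m ^ 2) * e +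
          (1 + d ^ 3 - l * m * (l + m))) := fun d l m e => by
      congr 1
      grind
    have hTd : ∀ d, ∑ e, T d e = ∑ l, ∑ m,
        (1 - indZero (1 + d ^ 3 - 3 * w * d * l * m - w * l ^ 2 * m - w ^ 2 * l * m ^ 2) +
          Fintype.card F *
            (indZero (1 + d ^ 3 - 3 * w * d * l * m - w * l ^ 2 * m - w ^ 2 * l * m ^ 2) *
              indZero (1 + d ^ 3 - l * m * (l + m)))) := by
      intro d
      rw [hT]
      dsimp only
      rw [Finset.sum_comm]
      refine Finset.sum_congr rfl fun l _ => ?_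
      rw [Finset.sum_comm]
      refine Finset.sum_congr rfl fun m _ => ?_
      simp_rw [he, sum_indZero_linear, indZero_mul_left (pow_ne_zero 2 hw0)]
    simp_rw [hTd, Finset.sum_add_distrib, Finset.sum_sub_distrib, ← Finset.mul_sum,
      sum_indZero_singular_cubic_surface h3 hw, sum_indZero_both_coefficients h3 hw]
    simp
    ring
  rw [hxy]
  simp_rw [hsplit, Finset.sum_add_distrib, Finset.sum_sub_distrib, hS1, hS2, hT1, hT2, hT3]
  ring

theorem sum_indZero_burkhardt_of_cube_root (h3 : (3 : F) ≠ 0) (hw : w ^ 2 + w + 1 = 0) :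
    ∑ a : F, ∑ b : F, ∑ c : F, ∑ d : F, ∑ e : F,
        indZero (a * (a ^ 3 + b ^ 3 + c ^ 3 + d ^ 3 + e ^ 3) + 3 * b * c * d * e) =
      (Fintype.card F : ℤ) ^ 4 - (Fintype.card F - 1) ^ 4 +
        (Fintype.card F - 1) * ((Fintype.card F : ℤ) ^ 3 + 12 * (Fintype.card F : ℤ) ^ 2 -
          27 * Fintype.card F - 1) := by
  rw [sum_indZero_quartic (f := fun a b c d e => a * (a ^ 3 + b ^ 3 + c ^ 3 + d ^ 3 + e ^ 3) +
    3 * b * c * d * e) (fun t a b c d e => by ring), sum_indZero_burkhardt_chart h3 hw]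
  simp only [zero_mul, zero_add]
  rw [sum_indZero_mul_four h3]

end CubeRootOfUnity

/-! ### Points of the Burkhardt quartic over a finite field -/

section Points

theorem sum_fin_succ_pi {F : Type*} [Fintype F] {n : ℕ} (f : (Fin (n + 1) → F) → ℤ) :
    ∑ v, f v = ∑ a, ∑ v : Fin n → F, f (Fin.cons a v) := by
  rw [← Fintype.sum_prod_type' fun a (v : Fin n → F) => f (Fin.cons a v)]
  exact ((Fin.consEquiv fun _ => F).sum_comp f).symm

/-- Cubing is bijective on a field with `q ≡ 2 (mod 3)` elements. -/
theorem cube_bijective_of_card {F : Type*} [Field F] [Fintype F] (h : Fintype.card F % 3 = 2) :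
    Function.Bijective fun x : F => x ^ 3 := by
  classical
  refine Finite.injective_iff_bijective.1 fun x y hxy => ?_
  have hxy : x ^ 3 = y ^ 3 := hxy
  by_cases hy : y = 0
  · subst hy
    simpa using hxy
  have h1 : (x / y) ^ 3 = 1 := by
    rw [div_pow, hxy, div_self (pow_ne_zero 3 hy)]
  have hx : x / y ≠ 0 := fun h0 => by simp [h0] at h1
  have h2 := FiniteField.pow_card_sub_one_eq_one (x / y) hx
  obtain ⟨k, hk⟩ : ∃ k, Fintype.card F - 1 = 3 * k + 1 := ⟨Fintype.card F / 3, by lia⟩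
  rw [hk, pow_succ, pow_mul, h1, one_pow, one_mul] at h2
  exact (div_eq_one_iff_eq hy).1 h2

/-- A field with `q ≡ 1 (mod 3)` elements contains a primitive cube root of unity. -/
theorem exists_omega_of_card {F : Type*} [Field F] [Fintype F] (h : Fintype.card F % 3 = 1) :
    ∃ w : F, w ^ 2 + w + 1 = 0 := by
  classical
  have hdvd : 3 ∣ Fintype.card Fˣ := by
    rw [Fintype.card_units]
    lia
  have : Fact (Nat.Prime 3) := ⟨Nat.prime_three⟩
  obtain ⟨u, hu⟩ := exists_prime_orderOf_dvd_card 3 hdvd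
  have h1 : (u : F) ^ 3 = 1 := by
    rw [← Units.val_pow_eq_pow_val, ← hu, pow_orderOf_eq_one, Units.val_one]
  refine ⟨u, ?_⟩
  have h2 : ((u : F) - 1) * ((u : F) ^ 2 + u + 1) = 0 := by linear_combination h1
  refine (mul_eq_zero.1 h2).resolve_left fun h3 => ?_
  have : u = 1 := Units.ext (sub_eq_zero.1 h3)
  simp [this] at hu

theorem eq_zero_of_norm_eq_zero {F : Type*} [Field F] (h3 : (3 : F) ≠ 0)
    (hcube : Function.Injective fun x : F => x ^ 3) (u v : F) (h : u ^ 2 + u * v + v ^ 2 = 0) :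
    v = 0 := by
  have huv : u = v := hcube (show u ^ 3 = v ^ 3 by linear_combination (u - v) * h)
  subst huv
  have : 3 * u ^ 2 = 0 := by linear_combination h
  simpa [h3] using this

/-- The number of zeros of the Burkhardt form in the affine space `F ^ 5`; here `s` is the Legendre
symbol of the number of elements of `F` modulo `3`. -/
theorem sum_indZero_burkhardt {F : Type*} [Field F] [Fintype F] {s : ℤ}
    (h3 : (3 : F) ≠ 0)
    (hs : Fintype.card F % 3 = 1 ∧ s = 1 ∨ Fintype.card F % 3 = 2 ∧ s = -1) :
    ∑ a : F, ∑ b : F, ∑ c : F, ∑ d : F, ∑ e : F,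
        indZero (a * (a ^ 3 + b ^ 3 + c ^ 3 + d ^ 3 + e ^ 3) + 3 * b * c * d * e) =
      1 + (Fintype.card F - 1) * ((Fintype.card F : ℤ) ^ 3 +
        (10 + 6 * s) * (Fintype.card F : ℤ) ^ 2 - (15 + 14 * s) * Fintype.card F + 1) := by
  rcases hs with ⟨hF, rfl⟩ | ⟨hF, rfl⟩
  · obtain ⟨w, hw⟩ := exists_omega_of_card hF
    rw [sum_indZero_burkhardt_of_cube_root h3 hw]
    ring
  · have hcube := cube_bijective_of_card hF
    rw [sum_indZero_burkhardt_of_cube_bijective h3 hcube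
      (eq_zero_of_norm_eq_zero h3 hcube.injective)]
    ring

/-- The nonzero vectors in the affine cone over a projective algebraic set are the multiples, by
units, of the representatives of its points. -/
theorem card_cone {K : Type*} [Field K] {n : ℕ} (X : ProjectiveAlgebraicSet K n)
    (L : Type*) [Field L] [Algebra K L] :
    Nat.card {v : Fin (n + 1) → L // v ≠ 0 ∧ ∀ F ∈ X.equations, MvPolynomial.aeval v F = 0} =
      Nat.card (X.points L) * Nat.card Lˣ := by
  rw [← Nat.card_prod]
  symm
  have hne : ∀ (u : Lˣ) (P : ℙ L (Fin (n + 1) → L)), u • P.rep ≠ 0 := fun u P =>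
    (smul_ne_zero_iff_ne u).2 P.rep_nonzero
  have hmk : ∀ (u : Lˣ) (P : ℙ L (Fin (n + 1) → L)),
      Projectivization.mk L (u • P.rep) (hne u P) = P := fun u P => by
    conv_rhs => rw [← P.mk_rep]
    exact (Projectivization.mk_eq_mk_iff L _ _ _ _).2 ⟨u, rfl⟩
  refine Nat.card_congr (Equiv.ofBijective (fun p : X.points L × Lˣ =>
    ⟨p.2 • (p.1 : ℙ L (Fin (n + 1) → L)).rep, hne _ _, ?_⟩) ⟨?_, ?_⟩)
  · rw [← X.mk_mem_points_iff L _ (hne _ _), hmk]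
    exact p.1.2
  · rintro ⟨⟨P, hP⟩, u⟩ ⟨⟨Q, hQ⟩, t⟩ h
    have h : u • P.rep = t • Q.rep := congrArg Subtype.val h
    have hPQ : P = Q := by
      rw [← hmk u P, ← hmk t Q]
      congr 1
    subst hPQ
    have hut : (u : L) = t := smul_left_injective L P.rep_nonzero h
    rw [Units.ext hut]
  · rintro ⟨v, hv, hF⟩
    obtain ⟨a, ha⟩ := Projectivization.exists_smul_eq_mk_rep L v hv
    refine ⟨⟨⟨Projectivization.mk L v hv, (X.mk_mem_points_iff L v hv).2 hF⟩, a⁻¹⟩, ?_⟩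
    refine Subtype.ext ?_
    change a⁻¹ • (Projectivization.mk L v hv).rep = v
    rw [← ha, inv_smul_smul]

theorem aeval_burkhardtForm {K : Type*} [Field K] {L : Type*} [Field L] [Algebra K L]
    (v : Fin 5 → L) :
    MvPolynomial.aeval v (burkhardtForm K) =
      v 0 * (v 0 ^ 3 + v 1 ^ 3 + v 2 ^ 3 + v 3 ^ 3 + v 4 ^ 3) +
        3 * v 1 * v 2 * v 3 * v 4 := by
  simp [burkhardtForm]

/-- The number of points of the Burkhardt quartic over a finite extension `L` of `K`. -/
theorem card_points_burkhardtQuartic {K : Type*} [Field K] {L : Type*} [Field L] [Finite L]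
    [Algebra K L] {s : ℤ} (h3 : (3 : L) ≠ 0)
    (hs : Nat.card L % 3 = 1 ∧ s = 1 ∨ Nat.card L % 3 = 2 ∧ s = -1) :
    (Nat.card ((burkhardtQuartic K).points L) : ℤ) =
      (Nat.card L : ℤ) ^ 3 + (10 + 6 * s) * (Nat.card L : ℤ) ^ 2 -
        (15 + 14 * s) * Nat.card L + 1 := by
  classical
  have := Fintype.ofFinite L
  simp only [Nat.card_eq_fintype_card (α := L)] at hs ⊢
  have hA := sum_indZero_burkhardt h3 hs
  have hcone := card_cone (burkhardtQuartic K) L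
  have hunits : (Nat.card Lˣ : ℤ) = Fintype.card L - 1 := by
    rw [Nat.card_eq_fintype_card, Fintype.card_units, Nat.cast_sub Fintype.card_pos]
    simp
  set f : (Fin 5 → L) → L := fun v =>
    v 0 * (v 0 ^ 3 + v 1 ^ 3 + v 2 ^ 3 + v 3 ^ 3 + v 4 ^ 3) + 3 * v 1 * v 2 * v 3 * v 4 with hf
  have hsum : ∑ v, indZero (f v) = ∑ a : L, ∑ b : L, ∑ c : L, ∑ d : L, ∑ e : L,
      indZero (a * (a ^ 3 + b ^ 3 + c ^ 3 + d ^ 3 + e ^ 3) + 3 * b * c * d * e) := by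
    simp only [sum_fin_succ_pi, Fintype.sum_unique]
    rfl
  have hcard : ∑ v, indZero (f v) = 1 + (Nat.card {v : Fin (4 + 1) → L //
      v ≠ 0 ∧ ∀ F ∈ (burkhardtQuartic K).equations, MvPolynomial.aeval v F = 0} : ℤ) := by
    have h1 : ∀ v, indZero (f v) =
        (if v = 0 then 1 else 0) + if v ≠ 0 ∧ f v = 0 then 1 else 0 := fun v => by
      by_cases hv : v = 0
      · subst hv
        simp [hf]
      · simp [hv, indZero]
    have h2 : ∀ v : Fin 5 → L, (v ≠ 0 ∧ ∀ F ∈ (burkhardtQuartic K).equations,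
        MvPolynomial.aeval v F = 0) ↔ v ≠ 0 ∧ f v = 0 := fun v => by
      simp [burkhardtQuartic, aeval_burkhardtForm, hf]
    rw [Nat.card_congr (Equiv.subtypeEquivRight h2), Nat.card_eq_fintype_card,
      Fintype.card_subtype, Finset.sum_congr rfl fun v _ => h1 v, Finset.sum_add_distrib]
    simp
  have hq : (Fintype.card L : ℤ) - 1 ≠ 0 := by
    have := Fintype.one_lt_card (α := L)
    lia
  refine mul_right_cancel₀ hq ?_
  have hcone' := congrArg (Nat.cast : ℕ → ℤ) hcone
  rw [Nat.cast_mul, hunits] at hcone'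
  linear_combination hA + hsum - hcard - hcone'

end Points

/-! ### Exponentials of logarithmic series -/

section ExpSubst

theorem hasSubst_of_constantCoeff {f : ℚ⟦X⟧} (hf : PowerSeries.constantCoeff f = 0) :
    PowerSeries.HasSubst f :=
  PowerSeries.HasSubst.of_constantCoeff_zero' hf

theorem constantCoeff_exp_subst {f : ℚ⟦X⟧} (hf : PowerSeries.constantCoeff f = 0) :
    PowerSeries.constantCoeff ((PowerSeries.exp ℚ).subst f) = 1 := by
  have hs := hasSubst_of_constantCoeff hf
  have h0 : PowerSeries.constantCoeff ((PowerSeries.exp ℚ - 1).subst f) = 0 :=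
    PowerSeries.constantCoeff_subst_eq_zero hf _ (by simp)
  have h1 : (1 : ℚ⟦X⟧).subst f = (1 : ℚ⟦X⟧) := by
    rw [← PowerSeries.coe_substAlgHom hs, map_one]
  rw [← sub_add_cancel (PowerSeries.exp ℚ) 1, PowerSeries.subst_add hs, h1, map_add, h0]
  simp

theorem derivative_exp_subst {f : ℚ⟦X⟧} (hf : PowerSeries.constantCoeff f = 0) :
    PowerSeries.derivative ℚ ((PowerSeries.exp ℚ).subst f) =
      (PowerSeries.exp ℚ).subst f * PowerSeries.derivative ℚ f := by
  rw [PowerSeries.derivative_subst (hasSubst_of_constantCoeff hf), PowerSeries.derivative_exp]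

/-- The linear differential equation `g' = g f'` determines `g` up to its constant term. -/
theorem eq_exp_subst {f g : ℚ⟦X⟧} (hf : PowerSeries.constantCoeff f = 0)
    (hg : PowerSeries.constantCoeff g = 1)
    (hD : PowerSeries.derivative ℚ g = g * PowerSeries.derivative ℚ f) :
    (PowerSeries.exp ℚ).subst f = g := by
  have hg0 : PowerSeries.constantCoeff g ≠ 0 := by simp [hg]
  have hinv := PowerSeries.mul_inv_cancel g hg0
  have h1 : (PowerSeries.exp ℚ).subst f * g⁻¹ = 1 := by
    refine PowerSeries.derivative.ext ?_ ?_
    · rw [Derivation.leibniz, PowerSeries.derivative_inv', derivative_exp_subst hf, hD,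
        Derivation.map_one_eq_zero]
      simp only [smul_eq_mul]
      linear_combination (-(PowerSeries.exp ℚ).subst f * PowerSeries.derivative ℚ f * g⁻¹) * hinv
    · simp [constantCoeff_exp_subst hf, hg]
  calc (PowerSeries.exp ℚ).subst f = (PowerSeries.exp ℚ).subst f * g⁻¹ * g := by
        rw [mul_assoc, mul_comm g⁻¹, hinv, mul_one]
    _ = g := by rw [h1, one_mul]

theorem exp_subst_add {f g : ℚ⟦X⟧} (hf : PowerSeries.constantCoeff f = 0)
    (hg : PowerSeries.constantCoeff g = 0) :
    (PowerSeries.exp ℚ).subst (f + g) =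
      (PowerSeries.exp ℚ).subst f * (PowerSeries.exp ℚ).subst g := by
  refine eq_exp_subst (by simp [hf, hg])
    (by simp [constantCoeff_exp_subst hf, constantCoeff_exp_subst hg]) ?_
  rw [Derivation.leibniz, derivative_exp_subst hf, derivative_exp_subst hg, map_add]
  simp only [smul_eq_mul]
  ring

theorem exp_subst_nsmul {f : ℚ⟦X⟧} (hf : PowerSeries.constantCoeff f = 0) (n : ℕ) :
    (PowerSeries.exp ℚ).subst (n • f) = (PowerSeries.exp ℚ).subst f ^ n := by
  induction n with
  | zero => exact eq_exp_subst (by simp) (by simp) (by simp)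
  | succ n ih => rw [succ_nsmul, exp_subst_add (by simp [hf]) hf, ih, pow_succ]

/-- The power series `∑_{n ≥ 1} cⁿ Tⁿ / n = -log (1 - c T)`. Its constant term is `1 / 0 = 0`. -/
noncomputable def logSeries (c : ℚ) : ℚ⟦X⟧ := PowerSeries.mk fun n => c ^ n / n

theorem constantCoeff_logSeries (c : ℚ) : PowerSeries.constantCoeff (logSeries c) = 0 := by
  rw [← PowerSeries.coeff_zero_eq_constantCoeff_apply, logSeries, PowerSeries.coeff_mk]
  simp

theorem one_sub_mul_derivative_logSeries (c : ℚ) :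
    (1 - PowerSeries.C c * PowerSeries.X) * PowerSeries.derivative ℚ (logSeries c) =
      PowerSeries.C c := by
  have h : ∀ n, PowerSeries.coeff n (PowerSeries.derivative ℚ (logSeries c)) = c ^ (n + 1) := by
    intro n
    rw [PowerSeries.coeff_derivative, logSeries, PowerSeries.coeff_mk]
    push_cast
    field_simp
  ext n
  rw [sub_mul, one_mul, mul_assoc, map_sub, h, PowerSeries.coeff_C_mul]
  cases n with
  | zero => simp
  | succ n => rw [PowerSeries.coeff_succ_X_mul, h, PowerSeries.coeff_C]; simp; ring

theorem exp_subst_logSeries (c : ℚ) :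
    (PowerSeries.exp ℚ).subst (logSeries c) = (1 - PowerSeries.C c * PowerSeries.X)⁻¹ := by
  have hinv := PowerSeries.mul_inv_cancel (1 - PowerSeries.C c * PowerSeries.X) (by simp)
  refine eq_exp_subst (constantCoeff_logSeries c) (by simp) ?_
  rw [PowerSeries.derivative_inv', map_sub, Derivation.map_one_eq_zero, Derivation.leibniz,
    PowerSeries.derivative_X, PowerSeries.derivative_C]
  simp only [smul_eq_mul, mul_zero, add_zero, mul_one, zero_sub, neg_mul_neg]
  linear_combination ((1 - PowerSeries.C c * PowerSeries.X)⁻¹ *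
    PowerSeries.derivative ℚ (logSeries c)) * hinv -
      (1 - PowerSeries.C c * PowerSeries.X)⁻¹ ^ 2 * one_sub_mul_derivative_logSeries c

end ExpSubst

/-! ### The zeta function of the Burkhardt quartic -/

theorem three_ne_zero_of_card {L : Type*} [Field L] [Finite L] (h : Nat.card L % 3 ≠ 0) :
    (3 : L) ≠ 0 := by
  intro h3
  have := Fintype.ofFinite L
  rw [Nat.card_eq_fintype_card] at h
  have hcard : ((Fintype.card L : ℕ) : L) = 0 := FiniteField.cast_card_eq_zero L
  rw [← Nat.div_add_mod (Fintype.card L) 3, Nat.cast_add, Nat.cast_mul, Nat.cast_ofNat, h3,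
    zero_mul, zero_add] at hcard
  have hr : Fintype.card L % 3 = 1 ∨ Fintype.card L % 3 = 2 := by lia
  rcases hr with hr | hr
  · rw [hr] at hcard
    simp at hcard
  · rw [hr] at hcard
    exact one_ne_zero (α := L) (by push_cast at hcard; linear_combination h3 - hcard)

/-- The sign attached to `q ^ n` modulo `3` is the `n`-th power of the Legendre symbol of `q`. -/
theorem legendreSym_three_pow {q : ℕ} (hq : ¬ 3 ∣ q) (n : ℕ) :
    q ^ n % 3 = 1 ∧ legendreSym 3 q ^ n = 1 ∨ q ^ n % 3 = 2 ∧ legendreSym 3 q ^ n = -1 := by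
  have h : q % 3 = 1 ∨ q % 3 = 2 := by lia
  rw [legendreSym.mod]
  rcases h with h | h
  · have h' : (q : ℤ) % (3 : ℕ) = 1 := by lia
    rw [h', legendreSym.at_one, Nat.pow_mod, h]
    simp
  · have h' : (q : ℤ) % (3 : ℕ) = 2 := by lia
    have h2 : legendreSym 3 2 = -1 := by decide
    rw [h', h2, Nat.pow_mod, h]
    rcases Nat.even_or_odd n with hn | hn
    · left
      obtain ⟨k, rfl⟩ := hn.two_dvd
      simp [pow_mul, Nat.pow_mod]
    · right
      obtain ⟨k, rfl⟩ := hn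
      simp [pow_succ, pow_mul, Nat.pow_mod, Nat.mul_mod]

theorem pointCount_burkhardtQuartic {K : Type*} [Field K] [Finite K] {q : ℕ} (hq : ¬ 3 ∣ q)
    (hK : Nat.card K = q) (n : ℕ) [NeZero n] :
    ((burkhardtQuartic K).pointCount n : ℤ) =
      ((q : ℤ) ^ n) ^ 3 + (10 + 6 * legendreSym 3 q ^ n) * ((q : ℤ) ^ n) ^ 2 -
        (15 + 14 * legendreSym 3 q ^ n) * (q : ℤ) ^ n + 1 := by
  have : Fact (ringChar K).Prime := ⟨CharP.char_is_prime K (ringChar K)⟩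
  have hcard : Nat.card (FiniteField.Extension K (ringChar K) n) = q ^ n := by
    rw [FiniteField.natCard_extension, hK]
  have hs := legendreSym_three_pow hq n
  have h := card_points_burkhardtQuartic (K := K) (L := FiniteField.Extension K (ringChar K) n)
    (s := legendreSym 3 q ^ n) (three_ne_zero_of_card (by rw [hcard]; lia)) (by rwa [hcard])
  rw [hcard] at h
  push_cast at h
  exact h

/-- The point counts of the Burkhardt quartic, as an identity of logarithmic series. -/
theorem logZeta_burkhardtQuartic {K : Type*} [Field K] [Finite K] {q : ℕ} (hq : ¬ 3 ∣ q)
    (hK : Nat.card K = q) :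
    (burkhardtQuartic K).logZeta + 15 • logSeries q + 14 • logSeries (legendreSym 3 q * q) =
      logSeries 1 + 10 • logSeries ((q : ℚ) ^ 2) + 6 • logSeries (legendreSym 3 q * q ^ 2) +
        logSeries ((q : ℚ) ^ 3) := by
  ext n
  cases n with
  | zero => simp [ProjectiveAlgebraicSet.logZeta, logSeries]
  | succ n =>
    have h := congrArg (Int.cast : ℤ → ℚ) (pointCount_burkhardtQuartic hq hK (n + 1))
    push_cast at h
    simp only [map_add, map_nsmul]
    simp only [ProjectiveAlgebraicSet.logZeta, logSeries, PowerSeries.coeff_mk, h, nsmul_eq_mul,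
      mul_pow]
    push_cast
    ring

theorem mul_eq_of_mul_inverses_eq {R : Type*} [CommRing R]
    {z a b c d u v a' b' c' d' u' v' : R} (ha : a * a' = 1) (hb : b * b' = 1) (hc : c * c' = 1)
    (hd : d * d' = 1) (hu : u * u' = 1) (hv : v * v' = 1)
    (h : z * u' ^ 15 * v' ^ 14 = a' * b' ^ 10 * c' ^ 6 * d') :
    z * (a * b ^ 10 * c ^ 6 * d) = u ^ 15 * v ^ 14 :=
  calc z * (a * b ^ 10 * c ^ 6 * d)
      = z * (a * b ^ 10 * c ^ 6 * d) * (u * u') ^ 15 * (v * v') ^ 14 := by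
        rw [hu, hv, one_pow, one_pow, mul_one, mul_one]
    _ = z * u' ^ 15 * v' ^ 14 * (a * b ^ 10 * c ^ 6 * d * (u ^ 15 * v ^ 14)) := by ring
    _ = a * a' * (b * b') ^ 10 * (c * c') ^ 6 * (d * d') * (u ^ 15 * v ^ 14) := by
        rw [h]
        ring
    _ = u ^ 15 * v ^ 14 := by
        rw [ha, hb, hc, hd]
        ring

theorem theorem2p2 (q : ℕ) (hq : ¬ 3 ∣ q) (K : Type*) [Field K] [Finite K]
    (hK : Nat.card K = q) (ε : ℤ) (hε : ε = legendreSym 3 (q : ℤ)) :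
    (burkhardtQuartic K).zeta =
      ((1 - (q : ℚ⟦X⟧) * PowerSeries.X) ^ 15 *
          (1 - (ε : ℚ⟦X⟧) * (q : ℚ⟦X⟧) * PowerSeries.X) ^ 14) *
        ((1 - PowerSeries.X) * (1 - (q : ℚ⟦X⟧) ^ 2 * PowerSeries.X) ^ 10 *
          (1 - (ε : ℚ⟦X⟧) * (q : ℚ⟦X⟧) ^ 2 * PowerSeries.X) ^ 6 *
          (1 - (q : ℚ⟦X⟧) ^ 3 * PowerSeries.X))⁻¹ := by
  have h0 := constantCoeff_logSeries
  have hL : PowerSeries.constantCoeff (burkhardtQuartic K).logZeta = 0 := by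
    rw [← PowerSeries.coeff_zero_eq_constantCoeff_apply, ProjectiveAlgebraicSet.logZeta,
      PowerSeries.coeff_mk]
  have key := congrArg (fun f => (PowerSeries.exp ℚ).subst f) (logZeta_burkhardtQuartic hq hK)
  rw [← hε] at key
  rw [exp_subst_add (by simp [hL, h0]) (by simp [h0]), exp_subst_add hL (by simp [h0]),
    exp_subst_add (by simp [h0]) (h0 _), exp_subst_add (by simp [h0]) (by simp [h0]),
    exp_subst_add (h0 _) (by simp [h0])] at key
  simp only [exp_subst_nsmul (h0 _), exp_subst_logSeries, map_mul, map_pow, map_natCast,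
    map_intCast, map_one, one_mul] at key
  have hinv : ∀ c : ℚ⟦X⟧, (1 - c * PowerSeries.X) * (1 - c * PowerSeries.X)⁻¹ = 1 := fun c =>
    PowerSeries.mul_inv_cancel _ (by simp)
  have h1 := hinv 1
  rw [one_mul] at h1
  rw [ProjectiveAlgebraicSet.zeta, PowerSeries.eq_mul_inv_iff_mul_eq (by simp)]
  exact mul_eq_of_mul_inverses_eq h1 (hinv (q ^ 2)) (hinv (ε * q ^ 2)) (hinv (q ^ 3)) (hinv q)
    (hinv (ε * q)) key
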